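/- Let $r\ge 0$ be an integer and let $0\le\delta\le\tfrac12$. A code $C\subseteq\mathbb F_2^n$ has locality $r$ if every coordinate $i\in\{1,\dots,n\}$ is contained in a set $\mathcal R_i\subseteq\{1,\dots,n\}$ of size $r+1$ for which there is a function $\phi_i:\mathbb F_2^{r}\to\mathbb F_2$ such that $c_i=\phi_i\big((c_j)_{j\in\mathcal R_i\setminus\{i\}}\big)$ for every codeword $c\in C$. Let $M^{\mathrm{lin}}(n,r,d)$ be the maximum cardinality of a linear code $C\subseteq\mathbb F_2^n$ with locality $r$ in which any two distinct codewords are at Hamming distance at least $d$, and let $$R^{\mathrm{lin}}(r,\delta)=\limsup_{n\to\infty}\frac1n\log_2 M^{\mathrm{lin}}(n,r,\delta n).$$ Let $h(x)=-x\log_2x-(1-x)\log_2(1-x)$ be the binary entropy function (with $0\log_2 0=0$) and, for $0\le\delta'\le1$, put $$R_0(r,\delta')=h(\tau)-c(r+1,\tau),\qquad \tau=\frac12-\sqrt{\delta'(1-\delta')},\qquad c(w,\tau)=\frac{\log_2 e}{8w^2}\Big(\frac{\tau^w}{2}\Big)^{w+1}.$$ **Theorem (Linear LRC codes).** The asymptotic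 rate of binary linear LRC codes with locality $r$ satisfies $$R^{\mathrm{lin}}(r,\delta)\le\min_{0\le s<1/(r+1)}\Big\{s\,r+(1-s(r+1))\,R_0\Big(r,\frac{\delta}{1-s(r+1)}\Big)\Big\},$$ where $s$ runs over the values with $\frac{\delta}{1-s(r+1)}\le 1$, so that the right-hand side is defined. The minimum is attained if $\delta>0$; for $\delta=0$ it is to be read as an infimum. -/

import Mathlib

namespace LRC

/-- A code `C ⊆ Qⁿ` is locally recoverable with locality `r`: every coordinate `i` lies in a
repair group `R` of size `r + 1` such that the `i`-th symbol of every codeword is a fixed function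
`φ` of the symbols in the recovery set `R \ {i}`. -/
def HasLocality {Q : Type*} {n : ℕ} (r : ℕ) (C : Set (Fin n → Q)) : Prop :=
  ∀ i : Fin n, ∃ R : Finset (Fin n), i ∈ R ∧ R.card = r + 1 ∧
    ∃ φ : ({j // j ∈ R.erase i} → Q) → Q, ∀ c ∈ C, c i = φ (fun j => c j)

/-- Any two distinct codewords of `C` are at Hamming distance at least `d`. -/
def HasDistance {Q : Type*} [DecidableEq Q] {n : ℕ} (d : ℝ) (C : Set (Fin n → Q)) : Prop :=
  ∀ x ∈ C, ∀ y ∈ C, x ≠ y → d ≤ (hammingDist x y : ℝ)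

/-- `M^lin(n, r, d)`: the maximum cardinality of a binary linear code of length `n`,
distance (at least) `d` and locality `r`. -/
noncomputable def maxLinCard (n r : ℕ) (d : ℝ) : ℕ :=
  sSup {M : ℕ | ∃ C : Submodule (ZMod 2) (Fin n → ZMod 2),
    HasDistance d (C : Set (Fin n → ZMod 2)) ∧
    HasLocality r (C : Set (Fin n → ZMod 2)) ∧ Nat.card C = M}

/-- `R^lin(r, δ) = limsup_{n → ∞} (1/n) log₂ M^lin(n, r, δ n)`. -/
noncomputable def linRate (r : ℕ) (δ : ℝ) : ℝ :=
  Filter.limsup (fun n : ℕ => 1 / (n : ℝ) * Real.logb 2 (maxLinCard n r (δ * n) : ℝ)) Filter.atTop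

/-- The binary entropy function `h(x) = - x log₂ x - (1 - x) log₂ (1 - x)`. -/
noncomputable def h (x : ℝ) : ℝ :=
  -x * Real.logb 2 x - (1 - x) * Real.logb 2 (1 - x)

/-- `τ(δ) = 1/2 - √(δ (1 - δ))`. -/
noncomputable def tau (δ : ℝ) : ℝ := 1 / 2 - Real.sqrt (δ * (1 - δ))

/-- `c(w, τ) = (log₂ e / (8 w²)) (τ^w / 2)^(w+1)`. -/
noncomputable def c (w : ℕ) (τ : ℝ) : ℝ :=
  Real.logb 2 (Real.exp 1) / (8 * (w : ℝ) ^ 2) * (τ ^ w / 2) ^ (w + 1)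

/-- `R₀(r, δ) = h(τ) - c(r + 1, τ)` with `τ = τ(δ)`. -/
noncomputable def R0 (r : ℕ) (δ : ℝ) : ℝ := h (tau δ) - c (r + 1) (tau δ)

/-- The expression that is minimized over `s`:
`s r + (1 - s (r+1)) R₀(r, δ / (1 - s (r+1)))`. -/
noncomputable def bound (r : ℕ) (δ s : ℝ) : ℝ :=
  s * r + (1 - s * (r + 1)) * R0 r (δ / (1 - s * (r + 1)))

/-- The range of `s`: all `0 ≤ s < 1/(r+1)` for which the second argument of `R₀` does not
exceed `1`, that is, for which the square root in `R₀` is that of a nonnegative number. -/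
def range (r : ℕ) (δ : ℝ) : Set ℝ :=
  {s | 0 ≤ s ∧ s < 1 / ((r : ℝ) + 1) ∧ δ / (1 - s * (r + 1)) ≤ 1}

end LRC

/-!
The bound has two independent ingredients, a linear programming bound for codes with sparse dual
words, and shortening.

**The covering inequality.** Let `C` be a linear code of length `n` and minimum distance `d`, and
let `f ≥ 0` be a function on the cube, supported on a set `B`, with `A f ≥ λ f` for the adjacency
operator `A` of the cube. Expanding `f` in the characters indexed by `C`, on which `A` acts with
the eigenvalues `n - 2 |c|`, and applying the Cauchy-Schwarz inequality, one finds that `B` meets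
at least `|C| (λ - n + 2 d) / (2 d)` cosets of the dual code (`card_le_card_syndromes`). For `B`
the ball of radius `τ n` an explicit radial function reaches every `λ < 2 √(τ (1 - τ)) n`
once `n` is large (`exists_test_function`), and some such `λ` exceeds `n - 2 d` by a multiple of `n`
for `d = δ n` as soon as `τ > τ(δ)`. Cosets are handled as syndromes, that is, as functionals on `C`.

**Few cosets meet the ball.** Choose one word of the ball in each coset that meets it. Under
independent bits of bias `τ` each of these words has probability at least `2 ^ (-n h(τ))`, so
their number is at most `2 ^ (n h(τ))` times the probability of the chosen set, and even of any set
of representatives that are at least as probable. Locality provides dual words of weight at most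
`w = r + 1` whose supports cover all coordinates. If these contained many disjoint supports, all
representatives that contain such a support could be replaced by lighter ones, and an exponential
factor would be gained. In general the supports become disjoint only after puncturing at a set `S`
of coordinates, which costs a factor `2 ^ #S`; a greedy construction finds `S` such that the gain
outweighs this cost (`exists_disjoint_blocks`), and the constant `c w τ` is what remains
(`card_le_of_syndrome_injOn`). Hence codes of locality `r` and relative distance `δ` have rate at
most `R0 r δ` (`exists_const_card_le_R0`).

**Shortening.** In a code of locality `r`, `⌈s n⌉` groups of `r + 1` coordinates can be selected one
after the other, each carrying at most `r` dimensions; shortening the code at these coordinates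
preserves locality and distance (`IsLocal.exists_shortened`). The rate bound for the shortened code
gives the term with parameter `s`. For `δ > 0` the range of `s` is a compact interval, on which the
bound is continuous, so that the minimum is attained.
-/

namespace LRC

open Finset

/-! ### The covering inequality -/

section

/-- The nontrivial real character of `ZMod 2`. -/
noncomputable def sgn (a : ZMod 2) : ℝ := if a = 0 then 1 else -1

lemma sgn_zero : sgn 0 = 1 := by simp [sgn]

lemma zmod_two_cases (a : ZMod 2) : a = 0 ∨ a = 1 := by
  revert a; decide

lemma sgn_add (a b : ZMod 2) : sgn (a + b) = sgn a * sgn b := by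
  rcases zmod_two_cases a with rfl | rfl <;> rcases zmod_two_cases b with rfl | rfl <;>
    simp [sgn, show (1 : ZMod 2) + 1 = 0 from rfl]

variable {ι : Type*} [Fintype ι]

/-- The syndrome of `x` with respect to the dual of `C`: the functional `c ↦ ∑ cᵢ xᵢ` on `C`.
Two vectors have the same syndrome if and only if they differ by an element of the dual code. -/
def syndrome (C : Submodule (ZMod 2) (ι → ZMod 2)) (x : ι → ZMod 2) : C → ZMod 2 :=
  fun c => c.1 ⬝ᵥ x

lemma sum_sgn (c : ι → ZMod 2) :
    ∑ i, sgn (c i) = Fintype.card ι - 2 * (hammingNorm c : ℝ) := by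
  have : ∀ i, sgn (c i) = 1 - 2 * (if c i ≠ 0 then (1 : ℝ) else 0) := by
    intro i
    by_cases hi : c i = 0 <;> simp [sgn, hi]; norm_num
  simp_rw [this, sum_sub_distrib, ← mul_sum, sum_boole, hammingNorm]
  simp

variable [DecidableEq ι]

open Classical in
/-- Orthogonality of the characters indexed by `C`. -/
lemma sum_sgn_syndrome (C : Submodule (ZMod 2) (ι → ZMod 2)) (x y : ι → ZMod 2) :
    ∑ c : C, sgn (c.1 ⬝ᵥ x) * sgn (c.1 ⬝ᵥ y) =
      if syndrome C x = syndrome C y then (Nat.card C : ℝ) else 0 := by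
  split_ifs with hxy
  · have : ∀ c : C, sgn (c.1 ⬝ᵥ x) * sgn (c.1 ⬝ᵥ y) = 1 := by
      intro c
      have : c.1 ⬝ᵥ x = c.1 ⬝ᵥ y := congrFun hxy c
      rw [this, ← sgn_add, CharTwo.add_self_eq_zero, sgn_zero]
    simp [this, Nat.card_eq_fintype_card]
  · obtain ⟨c₀, hc₀⟩ := Function.ne_iff.mp hxy
    have key : ∀ c : C, sgn (c.1 ⬝ᵥ x) * sgn (c.1 ⬝ᵥ y) = sgn (c.1 ⬝ᵥ (x + y)) := by
      intro c; rw [dotProduct_add, sgn_add]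
    have hc₁ : sgn (c₀.1 ⬝ᵥ (x + y)) = -1 := by
      have : c₀.1 ⬝ᵥ (x + y) ≠ 0 := by
        rw [dotProduct_add]
        intro h0
        exact hc₀ (CharTwo.add_eq_zero.mp h0)
      rw [sgn, if_neg this]
    simp_rw [key]
    have h1 := Equiv.sum_comp (Equiv.addRight c₀) (fun c : C => sgn (c.1 ⬝ᵥ (x + y)))
    have h2 : ∀ c : C, sgn ((Equiv.addRight c₀ c).1 ⬝ᵥ (x + y)) = - sgn (c.1 ⬝ᵥ (x + y)) := by
      intro c
      simp only [Equiv.coe_addRight, Submodule.coe_add, add_dotProduct, sgn_add, hc₁]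
      ring
    simp_rw [h2, sum_neg_distrib] at h1
    linarith

/-- The Fourier transform of `f`, evaluated at `c`. -/
noncomputable def fourier (f : (ι → ZMod 2) → ℝ) (c : ι → ZMod 2) : ℝ :=
  ∑ x, f x * sgn (c ⬝ᵥ x)

open Classical in
/-- Parseval's identity for the Fourier transform restricted to `C`. -/
lemma sum_fourier_mul_fourier (C : Submodule (ZMod 2) (ι → ZMod 2)) (f g : (ι → ZMod 2) → ℝ) :
    ∑ c : C, fourier f c * fourier g c =
      Nat.card C * ∑ x, ∑ y, if syndrome C x = syndrome C y then f x * g y else 0 := by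
  simp_rw [fourier, sum_mul_sum]
  rw [sum_comm]
  simp_rw [sum_comm (s := (univ : Finset C)), mul_sum]
  refine sum_congr rfl fun x _ => sum_congr rfl fun y _ => ?_
  have := sum_sgn_syndrome C x y
  calc _ = f x * g y * ∑ c : C, sgn (c.1 ⬝ᵥ x) * sgn (c.1 ⬝ᵥ y) := by
        rw [mul_sum]; exact sum_congr rfl fun c _ => by ring
    _ = _ := by rw [this]; split_ifs <;> ring

/-- The characters are eigenfunctions of the adjacency operator of the cube. -/
lemma fourier_adj (f : (ι → ZMod 2) → ℝ) (c : ι → ZMod 2) :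
    fourier (fun x => ∑ i, f (x + Pi.single i 1)) c =
      (Fintype.card ι - 2 * (hammingNorm c : ℝ)) * fourier f c := by
  rw [← sum_sgn, sum_mul, fourier]
  simp_rw [sum_mul]
  rw [sum_comm]
  refine sum_congr rfl fun i _ => ?_
  rw [fourier, mul_sum, ← Equiv.sum_comp (Equiv.addRight (Pi.single i (1 : ZMod 2)))]
  refine sum_congr rfl fun x _ => ?_
  have h2 : sgn (c i) * sgn (c i) = 1 := by
    rw [← sgn_add, CharTwo.add_self_eq_zero, sgn_zero]
  have h3 : x + Pi.single i (1 : ZMod 2) + Pi.single i 1 = x := by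
    rw [add_assoc, ← Pi.single_add, CharTwo.add_self_eq_zero, Pi.single_zero, add_zero]
  simp only [Equiv.coe_addRight, h3, dotProduct_add, dotProduct_single_one, sgn_add]
  linear_combination (0 : ℝ) * h2

open Classical in
/-- The covering inequality. A nonnegative function `f` supported on `B` with `A f ≥ lam • f`,
where `A` is the adjacency operator of the cube, forces the vectors of `B` to represent a
proportion of at least `(lam - n + 2 d) / (2 d)` of all syndromes. -/
theorem card_le_card_syndromes (C : Submodule (ZMod 2) (ι → ZMod 2)) {d lam : ℝ} (hd0 : 0 ≤ d)
    (hd : ∀ c ∈ C, c ≠ 0 → d ≤ hammingNorm c) (B : Finset (ι → ZMod 2))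
    (f : (ι → ZMod 2) → ℝ) (hf0 : ∀ x, 0 ≤ f x) (hfB : ∀ x, x ∉ B → f x = 0)
    (hne : ∃ x, f x ≠ 0) (hA : ∀ x, lam * f x ≤ ∑ i, f (x + Pi.single i 1)) :
    (lam - (Fintype.card ι : ℝ) + 2 * d) * (Nat.card C : ℝ) ≤
      2 * d * (#(B.image (syndrome C)) : ℝ) := by
  set T := B.image (syndrome C)
  set F : (C → ZMod 2) → ℝ := fun t => ∑ x ∈ B with syndrome C x = t, f x with hF
  set N : ℝ := (Fintype.card ι : ℝ)
  set K : ℝ := (Nat.card C : ℝ)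
  set Q : ℝ := ∑ t ∈ T, F t ^ 2
  have hmaps : ∀ x ∈ B, syndrome C x ∈ T := fun x hx => mem_image_of_mem _ hx
  have hsumB : ∀ g : (ι → ZMod 2) → ℝ, (∀ x, x ∉ B → g x = 0) → ∑ x, g x = ∑ x ∈ B, g x :=
    fun g hg => (sum_subset (subset_univ B) fun x _ hx => hg x hx).symm
  have hpair : (∑ x, ∑ y, if syndrome C x = syndrome C y then f x * f y else 0) = Q := by
    rw [hsumB _ (fun x hx => by simp [hfB x hx])]
    rw [← sum_fiberwise_of_maps_to hmaps]
    refine sum_congr rfl fun t _ => ?_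
    rw [sq, hF, sum_mul]
    refine sum_congr rfl fun x hx => ?_
    rw [hsumB _ (fun y hy => by simp [hfB y hy]), mul_sum, sum_filter]
    refine sum_congr rfl fun y _ => ?_
    rw [(mem_filter.mp hx).2]
    simp only [eq_comm]
  have hf00 : fourier f 0 = ∑ t ∈ T, F t := by
    simp only [fourier, zero_dotProduct, sgn_zero, mul_one]
    rw [hsumB f hfB, hF, sum_fiberwise_of_maps_to hmaps]
  have hCS : fourier f 0 ^ 2 ≤ #T * Q := by
    rw [hf00]; exact sq_sum_le_card_mul_sum_sq
  have hpars : ∑ c : C, fourier f c ^ 2 = K * Q := by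
    simp_rw [sq]; rw [sum_fourier_mul_fourier, hpair]
  have hKpos : 0 < K := Nat.cast_pos.mpr Nat.card_pos
  have hQpos : 0 < Q := by
    obtain ⟨x, hx⟩ := hne
    have hxB : x ∈ B := by by_contra hxB; exact hx (hfB x hxB)
    have hFx : 0 < F (syndrome C x) :=
      lt_of_lt_of_le (lt_of_le_of_ne (hf0 x) (Ne.symm hx))
        (single_le_sum (f := f) (fun y _ => hf0 y) (mem_filter.mpr ⟨hxB, rfl⟩))
    exact sum_pos' (fun t _ => sq_nonneg _) ⟨_, hmaps x hxB, by positivity⟩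
  have hlow : lam * (K * Q) ≤ ∑ c : C, (N - 2 * hammingNorm c.1) * fourier f c ^ 2 := by
    have h1 : ∑ c : C, (N - 2 * hammingNorm c.1) * fourier f c ^ 2 =
        ∑ c : C, fourier f c * fourier (fun x => ∑ i, f (x + Pi.single i 1)) c := by
      refine sum_congr rfl fun c _ => ?_
      rw [fourier_adj]; ring
    rw [h1, sum_fourier_mul_fourier, ← hpair, mul_left_comm, mul_sum]
    refine mul_le_mul_of_nonneg_left (sum_le_sum fun x _ => ?_) hKpos.le
    rw [mul_sum]
    refine sum_le_sum fun y _ => ?_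
    split_ifs
    · calc lam * (f x * f y) = f x * (lam * f y) := by ring
        _ ≤ _ := mul_le_mul_of_nonneg_left (hA y) (hf0 x)
    · simp
  have hup : ∑ c : C, (N - 2 * hammingNorm c.1) * fourier f c ^ 2 ≤
      (N - 2 * d) * (K * Q) + 2 * d * fourier f 0 ^ 2 := by
    have h0 : ∑ c : C, (if c = 0 then 2 * d * fourier f c ^ 2 else 0) =
        2 * d * fourier f 0 ^ 2 := by
      rw [sum_ite_eq' univ (0 : C) (fun c : C => 2 * d * fourier f c ^ 2)]; simp
    rw [← h0, ← hpars, mul_sum, ← sum_add_distrib]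
    refine sum_le_sum fun c _ => ?_
    have hs := sq_nonneg (fourier f c)
    split_ifs with hc
    · subst hc; simp only [Submodule.coe_zero, hammingNorm_zero]; apply le_of_eq; push_cast; ring
    · have := hd c.1 c.2 (by simpa using hc)
      nlinarith
  have : ((lam - N + 2 * d) * K) * Q ≤ (2 * d * #T) * Q := by
    have := mul_le_mul_of_nonneg_left hCS (show 0 ≤ 2 * d by linarith)
    linarith
  exact le_of_mul_le_mul_right this hQpos

end

/-! ### An approximate eigenfunction supported on a ball -/

section

variable {ι : Type*} [Fintype ι] [DecidableEq ι]

lemma hammingNorm_add_single (x : ι → ZMod 2) (i : ι) :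
    hammingNorm (x + Pi.single i 1) =
      if x i = 0 then hammingNorm x + 1 else hammingNorm x - 1 := by
  have key : ∀ j, (x + Pi.single i 1 : ι → ZMod 2) j ≠ 0 ↔ if j = i then x i = 0 else x j ≠ 0 := by
    intro j
    by_cases hj : j = i
    · subst hj
      rcases zmod_two_cases (x j) with hx | hx <;>
        simp [hx, show (1 : ZMod 2) + 1 = 0 from rfl]
    · simp [hj]
  unfold hammingNorm
  split_ifs with hi
  · rw [← card_insert_of_notMem (a := i) (by simp [hi])]
    congr 1; ext j
    simp only [mem_filter_univ, mem_insert, key]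
    by_cases hj : j = i <;> simp [hj, hi]
  · rw [← card_erase_of_mem (a := i) (by simp [hi])]
    congr 1; ext j
    simp only [mem_filter_univ, mem_erase, key]
    by_cases hj : j = i <;> simp [hj, hi]

lemma sum_comp_hammingNorm_add_single (g : ℕ → ℝ) (x : ι → ZMod 2) :
    ∑ i, g (hammingNorm (x + Pi.single i 1)) =
      hammingNorm x * g (hammingNorm x - 1) +
        (Fintype.card ι - hammingNorm x : ℝ) * g (hammingNorm x + 1) := by
  simp_rw [hammingNorm_add_single, apply_ite g]
  rw [sum_ite, sum_const, sum_const, nsmul_eq_mul, nsmul_eq_mul, add_comm]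
  have h1 : #{i | ¬ x i = 0} = hammingNorm x := rfl
  have h2 : (#{i | x i = 0} : ℝ) = Fintype.card ι - hammingNorm x := by
    have := card_filter_add_card_filter_not (s := (univ : Finset ι)) (fun i => x i = 0)
    rw [h1, card_univ] at this
    rw [← this]; push_cast; ring
  rw [h1, h2]

/-- The truncated parabola `θ ^ i (i - a)⁺ (a + l + 1 - i)⁺`, supported on `a < i ≤ a + l`. -/
noncomputable def parabola (θ : ℝ) (a l i : ℕ) : ℝ :=
  θ ^ i * max 0 (((i : ℝ) - a) * (a + l + 1 - i))

lemma parabola_nonneg {θ : ℝ} (hθ : 0 < θ) (a l i : ℕ) : 0 ≤ parabola θ a l i :=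
  mul_nonneg (by positivity) (le_max_left _ _)

/-- The truncated parabola is an approximate eigenfunction of the adjacency operator on radial
functions: with `u` the parabola, `u (i - 1) + u (i + 1) = 2 u i - 2 ≥ (2 - 2 / l) u i` on the
window, where `u i ≥ l`, and the truncation only increases the neighbouring values. -/
lemma parabola_step {θ W n m : ℝ} {a l i : ℕ} (hθ : 0 < θ) (hl : 0 < l) (hW : 0 ≤ W)
    (hm : m ≤ (2 - 2 / l) * W) (hin : i ≤ n) (hW1 : a + 1 ≤ i → W ≤ i / θ)
    (hW2 : i ≤ a + l → W ≤ (n - i) * θ) :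
    m * parabola θ a l i ≤ i * parabola θ a l (i - 1) + (n - i) * parabola θ a l (i + 1) := by
  have hl0 : (0 : ℝ) < l := Nat.cast_pos.mpr hl
  set u : ℝ → ℝ := fun i => (i - a) * (a + l + 1 - i) with hu
  have hg : ∀ i : ℕ, parabola θ a l i = θ ^ i * max 0 (u i) := fun i => rfl
  rcases le_or_gt (u i) 0 with hui | hui
  · have h0 : parabola θ a l i = 0 := by rw [hg, max_eq_left hui, mul_zero]
    rw [h0, mul_zero]
    have := parabola_nonneg hθ a l (i - 1)
    have := parabola_nonneg hθ a l (i + 1)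
    have : 0 ≤ n - i := by linarith
    positivity
  · -- inside the window, where `a < i < a + l + 1`
    have hai : (a : ℝ) < i ∧ (i : ℝ) < a + l + 1 := by
      rcases pos_and_pos_or_neg_and_neg_of_mul_pos hui with ⟨h, h'⟩ | ⟨h, h'⟩
      · exact ⟨by linarith, by linarith⟩
      · exfalso; linarith
    have hai1 : a + 1 ≤ i := by exact_mod_cast hai.1
    have hib : i ≤ a + l := by
      have : i < a + l + 1 := by exact_mod_cast hai.2
      omega
    obtain ⟨j, rfl⟩ : ∃ j, i = j + 1 := ⟨i - 1, by omega⟩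
    have hajR : (a : ℝ) ≤ j := by exact_mod_cast (by omega : a ≤ j)
    have hjbR : (j : ℝ) + 1 ≤ a + l := by exact_mod_cast hib
    rw [Nat.cast_add_one] at *
    have hul : l ≤ u (j + 1) := by simp only [hu]; nlinarith
    have hsum : (2 - 2 / l) * u (j + 1) ≤ u j + u (j + 2) := by
      have h1 : u j + u (j + 2) = 2 * u (j + 1) - 2 := by simp only [hu]; ring
      have h2 : 2 ≤ 2 / l * u (j + 1) := by
        rw [div_mul_eq_mul_div, le_div_iff₀ hl0]; linarith
      linarith
    have e1 : ((j : ℝ) + 1) * parabola θ a l (j + 1 - 1) =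
        θ ^ (j + 1) * ((j + 1) / θ * max 0 (u j)) := by
      rw [hg, Nat.add_sub_cancel, pow_succ]; field_simp
    have e2 : (n - (j + 1)) * parabola θ a l (j + 1 + 1) =
        θ ^ (j + 1) * ((n - (j + 1)) * θ * max 0 (u (j + 2))) := by
      rw [hg, pow_succ θ (j + 1)]
      have : ((j + 1 + 1 : ℕ) : ℝ) = j + 2 := by push_cast; ring
      rw [this]; ring
    have e3 : parabola θ a l (j + 1) = θ ^ (j + 1) * u (j + 1) := by
      rw [hg, Nat.cast_add_one, max_eq_right hui.le]
    rw [e1, e2, e3, ← mul_add, mul_left_comm]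
    refine mul_le_mul_of_nonneg_left ?_ (by positivity)
    calc m * u (j + 1) ≤ (2 - 2 / l) * W * u (j + 1) := mul_le_mul_of_nonneg_right hm hui.le
      _ = W * ((2 - 2 / l) * u (j + 1)) := by ring
      _ ≤ W * (max 0 (u j) + max 0 (u (j + 2))) := by
          refine mul_le_mul_of_nonneg_left (hsum.trans ?_) hW
          exact add_le_add (le_max_right _ _) (le_max_right _ _)
      _ ≤ _ := by
          rw [mul_add]
          exact add_le_add (mul_le_mul_of_nonneg_right (hW1 hai1) (le_max_left _ _))
            (mul_le_mul_of_nonneg_right (hW2 hib) (le_max_left _ _))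

/-- For `m < 2 √(τ (1 - τ))`, the adjacency operator of a large cube of dimension `n`, restricted
to the ball of radius `τ n`, has a nonnegative approximate eigenfunction of eigenvalue `m n`.
It is radial, `f x = θ ^ |x| v(|x|)`, with `v` a concave parabola on a window of bounded length
that ends at the boundary of the ball. -/
lemma exists_test_function {τ m : ℝ} (h0 : 0 < τ) (h1 : τ < 1)
    (hm : m < 2 * Real.sqrt (τ * (1 - τ))) :
    ∃ n₀ : ℕ, ∀ (ι : Type) [Fintype ι] [DecidableEq ι], n₀ ≤ Fintype.card ι →
      ∃ f : (ι → ZMod 2) → ℝ, (∀ x, 0 ≤ f x) ∧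
        (∀ x, τ * Fintype.card ι < hammingNorm x → f x = 0) ∧ (∃ x, f x ≠ 0) ∧
        ∀ x, m * Fintype.card ι * f x ≤ ∑ i, f (x + Pi.single i 1) := by
  set σ := Real.sqrt (τ * (1 - τ)) with hσ
  have hτ' : 0 < τ * (1 - τ) := mul_pos h0 (by linarith)
  have hσ0 : 0 < σ := Real.sqrt_pos.mpr hτ'
  have hσ2 : σ * σ = τ * (1 - τ) := Real.mul_self_sqrt hτ'.le
  set θ := τ / σ with hθ
  have hθ0 : 0 < θ := div_pos h0 hσ0
  have hθ1 : (1 - τ) * θ = σ := by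
    rw [hθ, ← mul_div_assoc, mul_comm, ← hσ2, mul_div_assoc, div_self hσ0.ne', mul_one]
  have hθ2 : τ = σ * θ := by rw [hθ]; field_simp
  -- the window length `l` makes the loss `2 / l` of the parabola negligible
  obtain ⟨l, hl⟩ := exists_nat_gt (2 * σ / (2 * σ - m) + 1)
  have hgap : 0 < 2 * σ - m := by linarith
  have hq : 0 < 2 * σ / (2 * σ - m) := by positivity
  have hl1 : (1 : ℝ) < l := by linarith
  have hl0 : (0 : ℝ) < l := by linarith
  have hml : 0 < (2 - 2 / l) * σ - m := by
    have : 2 * σ < l * (2 * σ - m) := by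
      rw [← div_lt_iff₀ hgap]; linarith
    have h2 : 2 * σ / l < 2 * σ - m := by rw [div_lt_iff₀ hl0]; linarith
    have h3 : (2 - 2 / (l : ℝ)) * σ = 2 * σ - 2 * σ / l := by ring
    linarith
  have hl2 : 0 ≤ 2 - 2 / (l : ℝ) := by
    have : 2 / (l : ℝ) ≤ 2 := by rw [div_le_iff₀ hl0]; linarith
    linarith
  obtain ⟨n₀, hn₀⟩ := exists_nat_gt
    (max ((l + 1) / τ) (((2 - 2 / l) * (l / θ)) / ((2 - 2 / l) * σ - m)))
  refine ⟨n₀, fun ι _ _ hn => ?_⟩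
  set n : ℝ := (Fintype.card ι : ℝ) with hnn
  have hnn₀ : (n₀ : ℝ) ≤ n := Nat.cast_le.mpr hn
  have hn1 : l + 1 < τ * n := by
    have := (le_max_left _ _).trans_lt hn₀
    rw [div_lt_iff₀ h0] at this
    nlinarith
  have hn2 : (2 - 2 / l) * (l / θ) ≤ ((2 - 2 / l) * σ - m) * n := by
    have := (le_max_right _ _).trans_lt hn₀
    rw [div_lt_iff₀ hml] at this
    nlinarith
  have hn0 : 0 < n := by
    by_contra h; nlinarith
  set b := ⌊τ * n⌋₊ with hb
  have hb1 : (b : ℝ) ≤ τ * n := Nat.floor_le (by positivity)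
  have hb2 : τ * n < b + 1 := Nat.lt_floor_add_one _
  have hbl : l ≤ b := by
    have : (l : ℝ) < b := by linarith
    exact_mod_cast this.le
  have hbn : b ≤ Fintype.card ι := by
    have : (b : ℝ) ≤ n := by nlinarith
    exact Nat.cast_le.mp this
  obtain ⟨a, hab⟩ : ∃ a, b = a + l := ⟨b - l, by omega⟩
  have habR : (b : ℝ) = a + l := by rw [hab]; push_cast; ring
  refine ⟨fun x => parabola θ a l (hammingNorm x), fun x => parabola_nonneg hθ0 _ _ _,
    fun x hx => ?_, ?_, fun x => ?_⟩
  · have hx2 : (b : ℝ) + 1 ≤ hammingNorm x := by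
      have hx1 : (b : ℝ) < hammingNorm x := by linarith
      have : b < hammingNorm x := by exact_mod_cast hx1
      exact_mod_cast this
    have : ((hammingNorm x : ℝ) - a) * (a + l + 1 - hammingNorm x) ≤ 0 := by
      apply mul_nonpos_of_nonneg_of_nonpos <;> linarith
    simp only [parabola, max_eq_left this, mul_zero]
  · obtain ⟨s, -, hs⟩ := exists_subset_card_eq (s := (univ : Finset ι)) (n := b)
      (by rwa [card_univ])
    refine ⟨fun i => if i ∈ s then 1 else 0, ?_⟩
    have hw : hammingNorm (fun i => if i ∈ s then (1 : ZMod 2) else 0) = b := by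
      simp [hammingNorm, hs]
    have hub : ((b : ℝ) - a) * (a + l + 1 - b) = l := by rw [habR]; ring
    simp only [hw, parabola, hub, max_eq_right hl0.le]
    positivity
  · rw [sum_comp_hammingNorm_add_single]
    have hin : hammingNorm x ≤ Fintype.card ι := hammingNorm_le_card_fintype
    have hW : (2 - 2 / l) * (σ * n - l / θ) =
      (2 - 2 / l) * σ * n - (2 - 2 / l) * (l / θ) := by ring
    refine parabola_step (W := σ * n - l / θ) hθ0 (Nat.cast_pos.mp hl0) ?_ (by linarith)
      (Nat.cast_le.mpr hin) (fun h => ?_) (fun h => ?_)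
    · rw [sub_nonneg, div_le_iff₀ hθ0, mul_right_comm, ← hθ2]
      linarith
    · have : (a : ℝ) + 1 ≤ hammingNorm x := by exact_mod_cast h
      rw [le_div_iff₀ hθ0, sub_mul, div_mul_cancel₀ _ hθ0.ne', mul_right_comm, ← hθ2]
      linarith
    · have h' : (hammingNorm x : ℝ) ≤ b := by rw [hab]; exact_mod_cast h
      have h1 : (n - τ * n) * θ ≤ (n - hammingNorm x) * θ :=
        mul_le_mul_of_nonneg_right (by linarith) hθ0.le
      have h2 : (n - τ * n) * θ = σ * n := by rw [← hθ1]; ring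
      have h3 : 0 < l / θ := by positivity
      linarith

end

/-! ### Product weights on the cube and disjoint blocks -/

section

variable {ι : Type*} [Fintype ι] [DecidableEq ι]

lemma sum_prod_zmod_two (f : ι → ZMod 2 → ℝ) :
    ∑ y : ι → ZMod 2, ∏ i, f i (y i) = ∏ i, (f i 0 + f i 1) := by
  rw [← Fintype.piFinset_univ, ← prod_univ_sum]
  refine prod_congr rfl fun i _ => ?_
  exact Fin.sum_univ_two (f i)

/-- For a product weight that is a probability on the disjoint blocks `Q j`, the events that `y`
is constantly `1` on `Q j` are independent. -/
lemma sum_prod_mul_prod_not_all_one {κ : Type*} [DecidableEq κ] (J : Finset κ)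
    (Q : κ → Finset ι) (hQ : ∀ j ∈ J, ∀ k ∈ J, j ≠ k → Disjoint (Q j) (Q k))
    (f : ι → ZMod 2 → ℝ) (hf : ∀ j ∈ J, ∀ i ∈ Q j, f i 0 + f i 1 = 1) :
    ∑ y : ι → ZMod 2, (∏ i, f i (y i)) * ∏ j ∈ J, (if ∀ i ∈ Q j, y i = 1 then 0 else 1) =
      (∏ i, (f i 0 + f i 1)) * ∏ j ∈ J, (1 - ∏ i ∈ Q j, f i 1) := by
  induction J using Finset.induction_on generalizing f with
  | empty => simpa using sum_prod_zmod_two f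
  | insert j J hj ih =>
    have hQJ : ∀ a ∈ J, ∀ k ∈ J, a ≠ k → Disjoint (Q a) (Q k) := fun a ha k hk =>
      hQ a (mem_insert_of_mem ha) k (mem_insert_of_mem hk)
    have hdisj : ∀ k ∈ J, ∀ i ∈ Q k, i ∉ Q j := fun k hk i hi hi' =>
      disjoint_left.mp (hQ j (mem_insert_self _ _) k (mem_insert_of_mem hk)
        (fun e => hj (e ▸ hk))) hi' hi
    -- the weight `f` restricted to the vectors that are constantly `1` on `Q j`
    set f' : ι → ZMod 2 → ℝ := fun i b => if i ∈ Q j ∧ b = 0 then 0 else f i b with hf'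
    have ih1 := ih hQJ f fun k hk => hf k (mem_insert_of_mem hk)
    have ih2 := ih hQJ f' fun k hk i hi => by
      simp only [hf', hdisj k hk i hi, false_and, if_false]
      exact hf k (mem_insert_of_mem hk) i hi
    have hsplit : ∀ y : ι → ZMod 2, ∏ i, f' i (y i) =
        if ∀ i ∈ Q j, y i = 1 then ∏ i, f i (y i) else 0 := by
      intro y
      split_ifs with hy
      · refine prod_congr rfl fun i _ => ?_
        by_cases hi : i ∈ Q j
        · simp [hf', hy i hi]
        · simp [hf', hi]
      · push Not at hy
        obtain ⟨i, hi, hyi⟩ := hy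
        refine prod_eq_zero (mem_univ i) ?_
        simp [hf', hi, (zmod_two_cases (y i)).resolve_right hyi]
    have hprod : ∏ i, (f' i 0 + f' i 1) = (∏ i, (f i 0 + f i 1)) * ∏ i ∈ Q j, f i 1 := by
      have : ∏ i ∈ Q j, f i 1 = ∏ i, if i ∈ Q j then f i 1 else 1 := by
        rw [prod_ite_mem, univ_inter]
      rw [this, ← prod_mul_distrib]
      refine prod_congr rfl fun i _ => ?_
      by_cases hi : i ∈ Q j
      · simp [hf', hi, hf j (mem_insert_self _ _) i hi]
      · simp [hf', hi]
    have hprod2 : ∏ k ∈ J, (1 - ∏ i ∈ Q k, f' i 1) = ∏ k ∈ J, (1 - ∏ i ∈ Q k, f i 1) := by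
      refine prod_congr rfl fun k _ => ?_
      congr 1
      refine prod_congr rfl fun i _ => ?_
      simp [hf']
    rw [hprod, hprod2] at ih2
    have hlhs : ∑ y : ι → ZMod 2, (∏ i, f i (y i)) *
          ∏ j ∈ insert j J, (if ∀ i ∈ Q j, y i = 1 then 0 else 1) =
        ∑ y : ι → ZMod 2, (∏ i, f i (y i)) * ∏ j ∈ J, (if ∀ i ∈ Q j, y i = 1 then 0 else 1) -
        ∑ y : ι → ZMod 2,
          (∏ i, f' i (y i)) * ∏ j ∈ J, (if ∀ i ∈ Q j, y i = 1 then 0 else 1) := by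
      rw [← sum_sub_distrib]
      refine sum_congr rfl fun y _ => ?_
      rw [prod_insert hj, hsplit]
      split_ifs <;> ring
    rw [hlhs, ih1, ih2, prod_insert hj]
    ring

end

/-! ### Puncturing to disjoint blocks -/

section

/-- Greedy construction of punctured disjoint blocks. For a covering of `ι` by sets `P i ∋ i` of
size at most `w`, there is a set `S` whose removal leaves many disjoint blocks `P j \ S`, where
"many" is relative to `#S`. If a maximal disjoint family of blocks is too small, its union is
added to `S`, and every remaining block loses an element; after `w` rounds all of `ι` would have
been absorbed into `S`, which is too large for the bounds on the families. -/
lemma exists_disjoint_blocks {ι : Type*} [Fintype ι] [DecidableEq ι] {w : ℕ} (P : ι → Finset ι)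
    (hP : ∀ i, i ∈ P i) (hw : ∀ i, #(P i) ≤ w) (a : ℕ → ℝ) (ha : ∀ k, 0 ≤ a k) {κ : ℝ}
    (hκ0 : 0 < κ) (hκ : κ * ∏ k ∈ Ioc 0 w, (1 + k * a k) ≤ Fintype.card ι) :
    ∃ (k : ℕ) (S J : Finset ι), (∀ j ∈ J, (P j \ S).Nonempty) ∧ (∀ j ∈ J, #(P j \ S) ≤ k) ∧
      (∀ i ∈ J, ∀ j ∈ J, i ≠ j → Disjoint (P i \ S) (P j \ S)) ∧ (#S + κ) * a k ≤ #J := by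
  by_contra! hcon
  have claim : ∀ m ≤ w, ∃ S : Finset ι, (∀ i, #(P i \ S) ≤ w - m) ∧
      #S + κ ≤ κ * ∏ k ∈ Ioc (w - m) w, (1 + k * a k) := by
    intro m
    induction m with
    | zero => exact fun _ => ⟨∅, by simpa using hw, by simp⟩
    | succ m ih =>
      intro hm
      obtain ⟨S, hS, hSκ⟩ := ih (by omega)
      obtain ⟨k, hk⟩ : ∃ k, w - m = k + 1 := ⟨w - m - 1, by omega⟩
      have hk' : w - (m + 1) = k := by omega
      rw [hk']
      rw [hk] at hS hSκ
      obtain ⟨J, hJ, hmax⟩ := exists_max_image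
        ({J | (∀ j ∈ J, (P j \ S).Nonempty) ∧
          ∀ i ∈ J, ∀ j ∈ J, i ≠ j → Disjoint (P i \ S) (P j \ S)} : Finset (Finset ι))
        card ⟨∅, by simp⟩
      obtain ⟨hJ1, hJ2⟩ := (mem_filter_univ _).mp hJ
      have hcard := hcon (k + 1) S J hJ1 (fun j _ => hS j) hJ2
      refine ⟨S ∪ J.biUnion (fun j => P j \ S), fun i => ?_, ?_⟩
      · -- by maximality, every nonempty block meets the union of the family
        rcases (P i \ S).eq_empty_or_nonempty with hi | hi
        · have : P i \ (S ∪ J.biUnion (fun j => P j \ S)) = ∅ := by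
            exact subset_empty.mp (hi ▸ sdiff_subset_sdiff Subset.rfl subset_union_left)
          simp [this]
        · have hmeet : ∃ j ∈ J, ¬ Disjoint (P i \ S) (P j \ S) := by
            by_contra! hdis
            have hiJ : i ∉ J := fun hiJ => by
              have := hdis i hiJ
              rw [disjoint_self_iff_empty] at this
              exact hi.ne_empty this
            have hins := hmax (insert i J) ((mem_filter_univ _).mpr ⟨?_, ?_⟩)
            · rw [card_insert_of_notMem hiJ] at hins; omega
            · intro j hj
              rcases mem_insert.mp hj with rfl | hj
              exacts [hi, hJ1 j hj]
            · intro j hj l hl hjl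
              rcases mem_insert.mp hj with rfl | hj' <;> rcases mem_insert.mp hl with rfl | hl'
              · exact absurd rfl hjl
              · exact hdis l hl'
              · exact (hdis j hj').symm
              · exact hJ2 j hj' l hl' hjl
          obtain ⟨j, hj, hij⟩ := hmeet
          obtain ⟨x, hxi, hxj⟩ := not_disjoint_iff.mp hij
          have hsub : P i \ (S ∪ J.biUnion (fun j => P j \ S)) ⊆ (P i \ S).erase x := by
            intro y hy
            rw [mem_sdiff, mem_union, not_or] at hy
            refine mem_erase.mpr ⟨?_, mem_sdiff.mpr ⟨hy.1, hy.2.1⟩⟩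
            rintro rfl
            exact hy.2.2 (mem_biUnion.mpr ⟨j, hj, hxj⟩)
          have := card_le_card hsub
          rw [card_erase_of_mem hxi] at this
          have := hS i
          omega
      · have h1 : #(S ∪ J.biUnion (fun j => P j \ S)) ≤ #S + #J * (k + 1) :=
          (card_union_le _ _).trans (Nat.add_le_add_left
            (card_biUnion_le_card_mul _ _ _ fun j _ => hS j) _)
        have h2 : (#(S ∪ J.biUnion (fun j => P j \ S)) : ℝ) ≤ #S + #J * (k + 1) := by
          exact_mod_cast h1
        have hIoc : Ioc k w = insert (k + 1) (Ioc (k + 1) w) := by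
          ext x; simp only [mem_Ioc, mem_insert]; omega
        rw [hIoc, prod_insert (by simp), mul_left_comm]
        have h3 : (0 : ℝ) ≤ 1 + ((k + 1 : ℕ) : ℝ) * a (k + 1) := by
          have := ha (k + 1); positivity
        refine le_trans ?_ (mul_le_mul_of_nonneg_left hSκ h3)
        have h4 := mul_le_mul_of_nonneg_right hcard.le (show (0 : ℝ) ≤ k + 1 by positivity)
        push_cast
        linarith
  obtain ⟨S, hS, hSκ⟩ := claim w le_rfl
  have hSu : S = univ := by
    refine eq_univ_iff_forall.mpr fun i => ?_
    have h0 : P i \ S = ∅ := card_eq_zero.mp (by have := hS i; omega)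
    exact sdiff_eq_empty_iff_subset.mp h0 (hP i)
  rw [hSu, card_univ, Nat.sub_self] at hSκ
  linarith

lemma prod_pow_two_mul_div_two (τ : ℝ) (w : ℕ) :
    ∏ k ∈ Ioc 0 w, (τ ^ (2 * k) / 2) = τ ^ (w * (w + 1)) / 2 ^ w := by
  induction w with
  | zero => simp
  | succ w ih =>
    have hIoc : Ioc 0 (w + 1) = insert (w + 1) (Ioc 0 w) := by
      ext x; simp only [mem_Ioc, mem_insert]; omega
    rw [hIoc, prod_insert (by simp), ih]
    rw [div_mul_div_comm, ← pow_add, pow_succ, mul_comm (2 : ℝ)]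
    congr 2
    ring

lemma c_pos {w : ℕ} (hw : 0 < w) {τ : ℝ} (h0 : 0 < τ) : 0 < c w τ := by
  have h1 : 0 < Real.logb 2 (Real.exp 1) :=
    Real.logb_pos (by norm_num) (by have := Real.add_one_lt_exp (x := 1) one_ne_zero; linarith)
  have h2 : (0 : ℝ) < w := Nat.cast_pos.mpr hw
  unfold c
  positivity

lemma logb_two_exp_one_le : Real.logb 2 (Real.exp 1) ≤ 2 := by
  rw [Real.logb, Real.log_exp, div_le_iff₀ (Real.log_pos (by norm_num))]
  have := Real.log_two_gt_d9
  linarith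

lemma logb_div_le_one {w : ℕ} (hw : 0 < w) :
    Real.logb 2 (Real.exp 1) / (8 * (w : ℝ) ^ 2) ≤ 1 := by
  have h2 : (1 : ℝ) ≤ w := by exact_mod_cast hw
  rw [div_le_one (by positivity)]
  have := logb_two_exp_one_le
  nlinarith

/-- The constant `c w τ` is small enough for the greedy construction of disjoint blocks: up to a
factor at most `1 / 2` it is the product of the `τ ^ (2 k) / 2` for `1 ≤ k ≤ w`, each of which
absorbs the factor with the same `k`. -/
lemma c_mul_prod_le_one {w : ℕ} (hw : 0 < w) {τ : ℝ} (h0 : 0 < τ) (h1 : τ ≤ 1 / 2) :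
    c w τ * ∏ k ∈ Ioc 0 w, (1 + k * (Real.log 2 / τ ^ k)) ≤ 1 := by
  have hc : (τ ^ w / 2) ^ (w + 1) = (∏ k ∈ Ioc 0 w, (τ ^ (2 * k) / 2)) / 2 := by
    rw [prod_pow_two_mul_div_two, div_pow, ← pow_mul, pow_succ 2, div_div]
  have hl0 : 0 < Real.log 2 := Real.log_pos (by norm_num)
  have hl1 : Real.log 2 ≤ 1 := by have := Real.log_two_lt_d9; linarith
  have hfac : ∀ k ∈ Ioc 0 w, τ ^ (2 * k) / 2 * (1 + k * (Real.log 2 / τ ^ k)) ≤ 1 := by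
    intro k _
    have hτk : 0 < τ ^ k := pow_pos h0 k
    have hτ1 : τ ^ k ≤ 1 := pow_le_one₀ h0.le (by linarith)
    have hk : k * τ ^ k ≤ 1 := by
      have h2 : (k : ℝ) ≤ 2 ^ k := by exact_mod_cast Nat.lt_two_pow_self.le
      calc k * τ ^ k ≤ 2 ^ k * (1 / 2) ^ k :=
            mul_le_mul h2 (pow_le_pow_left₀ h0.le h1 k) hτk.le (by positivity)
        _ = 1 := by rw [← mul_pow]; norm_num
    have e : τ ^ (2 * k) / 2 * (1 + k * (Real.log 2 / τ ^ k)) =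
        (τ ^ k * τ ^ k + k * τ ^ k * Real.log 2) / 2 := by
      rw [two_mul, pow_add]; field_simp
    rw [e]
    have h3 : τ ^ k * τ ^ k ≤ 1 := mul_le_one₀ hτ1 hτk.le hτ1
    have h4 : k * τ ^ k * Real.log 2 ≤ 1 := mul_le_one₀ hk hl0.le hl1
    linarith
  have hprod : (∏ k ∈ Ioc 0 w, (τ ^ (2 * k) / 2)) *
      ∏ k ∈ Ioc 0 w, (1 + k * (Real.log 2 / τ ^ k)) ≤ 1 := by
    rw [← prod_mul_distrib]
    exact prod_le_one (fun k _ => by positivity) hfac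
  have hpos : 0 ≤ (∏ k ∈ Ioc 0 w, (τ ^ (2 * k) / 2)) *
      ∏ k ∈ Ioc 0 w, (1 + k * (Real.log 2 / τ ^ k)) :=
    mul_nonneg (prod_nonneg fun k _ => by positivity) (prod_nonneg fun k _ => by positivity)
  have hlog : 0 ≤ Real.logb 2 (Real.exp 1) / (8 * (w : ℝ) ^ 2) :=
    div_nonneg (Real.logb_nonneg (by norm_num) (by
      have := Real.add_one_lt_exp (x := 1) one_ne_zero; linarith)) (by positivity)
  have := mul_le_one₀ (logb_div_le_one hw) hpos hprod
  rw [c, hc]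
  linarith

end

/-! ### Few syndromes in a ball -/

section

variable {ι : Type*} [Fintype ι]

lemma prod_ite_eq_zero_pow (τ : ℝ) (x : ι → ZMod 2) :
    ∏ i, (if x i = 0 then 1 - τ else τ) =
      (1 - τ) ^ (Fintype.card ι - hammingNorm x) * τ ^ hammingNorm x := by
  have h1 : #{i | ¬ x i = 0} = hammingNorm x := rfl
  have h2 : #{i | x i = 0} = Fintype.card ι - hammingNorm x := by
    have := card_filter_add_card_filter_not (s := (univ : Finset ι)) (fun i => x i = 0)
    rw [h1, card_univ] at this
    omega
  rw [prod_ite, prod_const, prod_const, h1, h2]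

/-- A word in the ball of radius `τ n` has probability at least `2 ^ (-n h(τ))` under independent
bits of bias `τ`. -/
lemma two_rpow_le_prod {τ : ℝ} (h0 : 0 < τ) (h1 : τ ≤ 1 / 2) (x : ι → ZMod 2)
    (hx : hammingNorm x ≤ τ * Fintype.card ι) :
    (2 : ℝ) ^ (-(Fintype.card ι * h τ)) ≤ ∏ i, (if x i = 0 then 1 - τ else τ) := by
  rw [prod_ite_eq_zero_pow]
  have hle : hammingNorm x ≤ Fintype.card ι := hammingNorm_le_card_fintype
  have h1' : 0 < 1 - τ := by linarith
  have hpos : 0 < (1 - τ) ^ (Fintype.card ι - hammingNorm x) * τ ^ hammingNorm x := by positivity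
  rw [← Real.le_logb_iff_rpow_le (by norm_num) hpos,
    Real.logb_mul (by positivity) (by positivity), Real.logb_pow, Real.logb_pow,
    Nat.cast_sub hle, h]
  have hmono : Real.logb 2 τ ≤ Real.logb 2 (1 - τ) :=
    Real.logb_le_logb_of_le (by norm_num) h0 (by linarith)
  nlinarith

variable [DecidableEq ι]

/-- A set `X` of words with distinct syndromes, each of probability at least `2 ^ (-n h(τ))`, is
smaller than `2 ^ (n h(τ))` by an exponential factor if the dual code has words of weight at most
`w` whose supports cover all coordinates. After puncturing at a set `S`, at the cost of a factor `2 ^ #S`, there are many dual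
words with disjoint supports, and every word of `X` can be replaced by a word of the same
syndrome and of no smaller probability which is not constantly `1` on any of these supports. -/
theorem card_le_of_syndrome_injOn {w : ℕ} (hw : 0 < w) (C : Submodule (ZMod 2) (ι → ZMod 2))
    (p : ι → ι → ZMod 2) (hpC : ∀ i, ∀ c ∈ C, c ⬝ᵥ p i = 0) (hpi : ∀ i, p i i ≠ 0)
    (hpw : ∀ i, hammingNorm (p i) ≤ w) {τ : ℝ} (h0 : 0 < τ) (h1 : τ ≤ 1 / 2)
    (X : Finset (ι → ZMod 2)) (hX : Set.InjOn (syndrome C) X)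
    (hXτ : ∀ x ∈ X,
      (2 : ℝ) ^ (-(Fintype.card ι * h τ)) ≤ ∏ i, (if x i = 0 then 1 - τ else τ)) :
    (#X : ℝ) ≤ 2 ^ (Fintype.card ι * (h τ - c w τ)) := by
  set n : ℝ := (Fintype.card ι : ℝ) with hn
  rcases isEmpty_or_nonempty ι with hι | hι
  · have hn0 : n = 0 := by simp [hn]
    rw [hn0, zero_mul, Real.rpow_zero]
    exact_mod_cast card_le_one_of_subsingleton X
  have hnpos : 0 < n := Nat.cast_pos.mpr Fintype.card_pos
  set P : ι → Finset ι := fun i => {j | p i j ≠ 0} with hP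
  have hcpos := c_pos hw h0
  have hl0 : 0 < Real.log 2 := Real.log_pos (by norm_num)
  obtain ⟨k, S, J, hJne, hJk, hJd, hJ⟩ := exists_disjoint_blocks P (fun i => by simp [hP, hpi])
    hpw (fun k => Real.log 2 / τ ^ k) (fun k => by positivity) (κ := n * c w τ) (by positivity)
    (by
      have := mul_le_mul_of_nonneg_left (c_mul_prod_le_one hw h0 h1) hnpos.le
      rw [mul_one, ← mul_assoc] at this
      exact this)
  set Q : ι → Finset ι := fun j => P j \ S with hQ
  have hQp : ∀ j, ∀ i, i ∉ S → (i ∈ Q j ↔ p j i ≠ 0) := fun j i hi => by simp [hQ, hP, hi]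
  -- flip the blocks on which `x` is constantly `1`
  set Φ : (ι → ZMod 2) → ι → ZMod 2 := fun x =>
    x + ∑ j ∈ J, if ∀ i ∈ Q j, x i = 1 then p j else 0 with hΦ
  have hΦsyn : ∀ x, syndrome C (Φ x) = syndrome C x := by
    intro x
    funext c
    simp only [syndrome, hΦ, dotProduct_add, dotProduct_sum]
    rw [sum_eq_zero, add_zero]
    intro j _
    split_ifs
    · exact hpC j c.1 c.2
    · exact dotProduct_zero _
  have hΦQ : ∀ x, ∀ j ∈ J, ∀ i ∈ Q j,
      Φ x i = x i + (if ∀ i ∈ Q j, x i = 1 then 1 else 0) := by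
    intro x j hj i hi
    have hiS : i ∉ S := (mem_sdiff.mp hi).2
    simp only [hΦ, Pi.add_apply, Finset.sum_apply]
    rw [sum_eq_single_of_mem j hj]
    · have hpj := (zmod_two_cases (p j i)).resolve_left ((hQp j i hiS).mp hi)
      split_ifs
      · rw [hpj]
      · rfl
    · intro l hl hlj
      have : i ∉ Q l := fun hil => disjoint_left.mp (hJd l hl j hj hlj) hil hi
      have : p l i = 0 := by
        by_contra hne; exact this ((hQp l i hiS).mpr hne)
      split_ifs
      · exact this
      · rfl
  have hΦS : ∀ x, ∀ i ∉ S, Φ x i = x i ∨ (x i = 1 ∧ Φ x i = 0) := by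
    intro x i hiS
    by_cases hiQ : ∃ j ∈ J, i ∈ Q j
    · obtain ⟨j, hj, hi⟩ := hiQ
      rw [hΦQ x j hj i hi]
      split_ifs with hall
      · right; rw [hall i hi]; exact ⟨rfl, rfl⟩
      · left; rw [add_zero]
    · left
      push Not at hiQ
      simp only [hΦ, Pi.add_apply, Finset.sum_apply]
      rw [sum_eq_zero, add_zero]
      intro j hj
      have : p j i = 0 := by
        by_contra hne; exact hiQ j hj ((hQp j i hiS).mpr hne)
      split_ifs
      · exact this
      · rfl
  have hΦall : ∀ x, ∀ j ∈ J, ¬ ∀ i ∈ Q j, Φ x i = 1 := by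
    intro x j hj hall
    obtain ⟨i, hi⟩ := hJne j hj
    by_cases hx : ∀ i ∈ Q j, x i = 1
    · have := hall i hi
      rw [hΦQ x j hj i hi, if_pos hx, hx i hi] at this
      exact absurd this (by decide)
    · refine hx fun i hi => ?_
      have := hall i hi
      rwa [hΦQ x j hj i hi, if_neg hx, add_zero] at this
  -- the weight of the punctured word
  set f : ι → ZMod 2 → ℝ := fun i b => if i ∈ S then 1 else if b = 0 then 1 - τ else τ with hf
  set G : (ι → ZMod 2) → ℝ := fun y =>
    (∏ i, f i (y i)) * ∏ j ∈ J, (if ∀ i ∈ Q j, y i = 1 then 0 else 1) with hG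
  have hf0 : ∀ i b, 0 ≤ f i b := by
    intro i b; simp only [hf]; split_ifs <;> linarith
  have hG0 : ∀ y, 0 ≤ G y := fun y => mul_nonneg (prod_nonneg fun i _ => hf0 _ _)
    (prod_nonneg fun j _ => by split_ifs <;> norm_num)
  have hlow : ∀ x ∈ X, (2 : ℝ) ^ (-(n * h τ)) ≤ G (Φ x) := by
    intro x hx
    refine (hXτ x hx).trans ?_
    have e : ∏ j ∈ J, (if ∀ i ∈ Q j, Φ x i = 1 then (0 : ℝ) else 1) = 1 :=
      prod_eq_one fun j hj => if_neg (hΦall x j hj)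
    simp only [hG]
    rw [e, mul_one]
    refine prod_le_prod (fun i _ => by split_ifs <;> linarith) fun i _ => ?_
    simp only [hf]
    by_cases hiS : i ∈ S
    · rw [if_pos hiS]; split_ifs <;> linarith
    · rw [if_neg hiS]
      rcases hΦS x i hiS with e | ⟨e1, e2⟩
      · rw [e]
      · rw [e1, e2, if_neg one_ne_zero, if_pos rfl]; linarith
  have hinj : Set.InjOn Φ X := by
    intro x hx y hy hxy
    refine hX hx hy ?_
    rw [← hΦsyn x, ← hΦsyn y, hxy]
  have hsum : #X * (2 : ℝ) ^ (-(n * h τ)) ≤ ∑ y, G y := by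
    calc #X * (2 : ℝ) ^ (-(n * h τ)) ≤ ∑ x ∈ X, G (Φ x) := by
          rw [← nsmul_eq_mul]; exact card_nsmul_le_sum _ _ _ hlow
      _ = ∑ y ∈ X.image Φ, G y := (sum_image hinj).symm
      _ ≤ ∑ y, G y := sum_le_sum_of_subset_of_nonneg (subset_univ _) fun y _ _ => hG0 y
  have hiS : ∀ j, ∀ i ∈ Q j, i ∉ S := fun j i hi => (mem_sdiff.mp hi).2
  have hGsum : ∑ y, G y = 2 ^ #S * ∏ j ∈ J, (1 - τ ^ #(Q j)) := by
    rw [sum_prod_mul_prod_not_all_one J Q hJd f]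
    · congr 1
      · rw [← prod_const, ← univ_inter S, ← prod_ite_mem]
        refine prod_congr rfl fun i _ => ?_
        by_cases hi : i ∈ S <;> simp [hf, hi]; norm_num
      · refine prod_congr rfl fun j _ => ?_
        rw [← prod_const]
        congr 1
        refine prod_congr rfl fun i hi => ?_
        simp [hf, hiS j i hi]
    · intro j _ i hi
      simp [hf, hiS j i hi]
  have hexp : ∑ y, G y ≤ 2 ^ (-(n * c w τ)) := by
    rw [hGsum]
    have hτk : 0 < τ ^ k := pow_pos h0 k
    calc (2 : ℝ) ^ #S * ∏ j ∈ J, (1 - τ ^ #(Q j))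
        ≤ 2 ^ #S * ∏ j ∈ J, Real.exp (-τ ^ k) := by
          refine mul_le_mul_of_nonneg_left (prod_le_prod (fun j _ => ?_) fun j hj => ?_)
            (by positivity)
          · have := pow_le_one₀ (n := #(Q j)) h0.le (by linarith)
            linarith
          · have e1 := pow_le_pow_of_le_one h0.le (by linarith) (hJk j hj)
            have e2 := Real.add_one_le_exp (-τ ^ k)
            linarith
      _ = Real.exp (#S * Real.log 2 - #J * τ ^ k) := by
          rw [prod_const, ← Real.exp_nat_mul, sub_eq_add_neg, Real.exp_add, mul_neg,
            Real.exp_nat_mul, Real.exp_log (by norm_num)]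
      _ ≤ Real.exp (Real.log 2 * (-(n * c w τ))) := by
          refine Real.exp_le_exp.mpr ?_
          have : (#S + n * c w τ) * Real.log 2 ≤ #J * τ ^ k := by
            rwa [← mul_div_assoc, div_le_iff₀ hτk] at hJ
          linarith
      _ = _ := by rw [Real.rpow_def_of_pos (by norm_num)]
  have hfin := hsum.trans hexp
  rw [Real.rpow_neg (by norm_num), ← div_eq_mul_inv, div_le_iff₀ (by positivity),
    ← Real.rpow_add (by norm_num)] at hfin
  refine hfin.trans_eq ?_
  congr 1; ring

end

/-! ### Rate bounds for local linear codes -/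

section

variable {ι : Type*} [Fintype ι]

/-- Locality of a linear code over an arbitrary index set: every coordinate `i` lies in a set `R`
of size at most `w` such that a codeword that vanishes on `R \ {i}` vanishes at `i`. -/
def IsLocal (w : ℕ) (C : Submodule (ZMod 2) (ι → ZMod 2)) : Prop :=
  ∀ i, ∃ R : Finset ι, i ∈ R ∧ #R ≤ w ∧ ∀ c ∈ C, (∀ j ∈ R, j ≠ i → c j = 0) → c i = 0

/-- Every coordinate of a local linear code is in the support of a dual word of small weight. -/
lemma IsLocal.exists_dual [DecidableEq ι] {w : ℕ} {C : Submodule (ZMod 2) (ι → ZMod 2)}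
    (hC : IsLocal w C) : ∃ p : ι → ι → ZMod 2, (∀ i, ∀ c ∈ C, c ⬝ᵥ p i = 0) ∧
      (∀ i, p i i ≠ 0) ∧ ∀ i, hammingNorm (p i) ≤ w := by
  have key : ∀ i, ∃ p : ι → ZMod 2, (∀ c ∈ C, c ⬝ᵥ p = 0) ∧ p i ≠ 0 ∧ hammingNorm p ≤ w := by
    intro i
    obtain ⟨R, hiR, hRw, hR⟩ := hC i
    set ev : ι → Module.Dual (ZMod 2) C := fun j => (LinearMap.proj j).comp C.subtype with hev
    have hspan : ev i ∈ Submodule.span (ZMod 2)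
        (Set.range fun j => if j ∈ R.erase i then ev j else 0) := by
      refine mem_span_of_iInf_ker_le_ker fun c hc => ?_
      rw [Submodule.mem_iInf] at hc
      refine hR c.1 c.2 fun j hj hji => ?_
      have := hc j
      rw [if_pos (mem_erase.mpr ⟨hji, hj⟩)] at this
      exact this
    obtain ⟨a, ha⟩ := (Submodule.mem_span_range_iff_exists_fun _).mp hspan
    refine ⟨Pi.single i 1 + fun j => if j ∈ R.erase i then a j else 0, fun c hc => ?_, ?_, ?_⟩
    · have := LinearMap.congr_fun ha ⟨c, hc⟩
      have h2 : c ⬝ᵥ (fun j => if j ∈ R.erase i then a j else 0) = c i := by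
        rw [LinearMap.sum_apply] at this
        refine Eq.trans (sum_congr rfl fun j _ => ?_) this
        beta_reduce
        by_cases hj : j ∈ R.erase i
        · rw [if_pos hj, if_pos hj, mul_comm]; rfl
        · rw [if_neg hj, if_neg hj, mul_zero, smul_zero]; rfl
      rw [dotProduct_add, h2, dotProduct_single_one, CharTwo.add_self_eq_zero]
    · simp
    · refine le_trans (card_le_card fun j hj => ?_) hRw
      by_contra hjR
      have hji : j ≠ i := fun e => hjR (e ▸ hiR)
      simp [hji, hjR] at hj
  choose p hp using key
  exact ⟨p, fun i => (hp i).1, fun i => (hp i).2.1, fun i => (hp i).2.2⟩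

lemma le_h {τ : ℝ} (h0 : 0 ≤ τ) (h1 : τ ≤ 1 / 2) : τ ≤ h τ := by
  rcases h0.eq_or_lt with rfl | h0
  · simp [h]
  have e1 : Real.logb 2 τ ≤ -1 := by
    rw [Real.logb_le_iff_le_rpow (by norm_num) h0, Real.rpow_neg_one]; linarith
  have e2 : Real.logb 2 (1 - τ) ≤ 0 := Real.logb_nonpos (by norm_num) (by linarith) (by linarith)
  rw [h]
  nlinarith

lemma c_le {w : ℕ} (hw : 0 < w) {τ : ℝ} (h0 : 0 ≤ τ) (h1 : τ ≤ 1) : c w τ ≤ τ := by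
  have e1 : τ ^ w ≤ τ := pow_le_of_le_one h0 h1 hw.ne'
  have e0 : 0 ≤ τ ^ w / 2 := by positivity
  have e2 : (τ ^ w / 2) ^ (w + 1) ≤ τ ^ w / 2 :=
    pow_le_of_le_one e0 (by linarith) (Nat.succ_ne_zero w)
  have e3 := mul_le_of_le_one_left (pow_nonneg e0 (w + 1)) (logb_div_le_one hw)
  rw [c]
  linarith

lemma h_sub_c_nonneg {w : ℕ} (hw : 0 < w) {τ : ℝ} (h0 : 0 ≤ τ) (h1 : τ ≤ 1 / 2) :
    0 ≤ h τ - c w τ := by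
  have := le_h h0 h1
  have := c_le hw h0 (h1.trans (by norm_num))
  linarith

variable [DecidableEq ι]

open Classical in
/-- The words of a set `B` of probable words represent few syndromes of a local code. -/
lemma IsLocal.card_syndromes_le {w : ℕ} (hw : 0 < w) {C : Submodule (ZMod 2) (ι → ZMod 2)}
    (hC : IsLocal w C) {τ : ℝ} (h0 : 0 < τ) (h1 : τ ≤ 1 / 2) (B : Finset (ι → ZMod 2))
    (hB : ∀ x ∈ B, (2 : ℝ) ^ (-(Fintype.card ι * h τ)) ≤ ∏ i, (if x i = 0 then 1 - τ else τ)) :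
    (#(B.image (syndrome C)) : ℝ) ≤ 2 ^ (Fintype.card ι * (h τ - c w τ)) := by
  obtain ⟨p, hp1, hp2, hp3⟩ := hC.exists_dual
  obtain ⟨X, hXB, hXinj, hX⟩ := exists_subset_injOn_image_eq_of_surjOn (f := syndrome C)
    B (B.image (syndrome C)) (by rw [coe_image]; exact Set.surjOn_image _ _)
  rw [← hX, card_image_of_injOn hXinj]
  exact card_le_of_syndrome_injOn hw C p hp1 hp2 hp3 h0 h1 X hXinj fun x hx => hB x (hXB hx)

/-- The bound at relative distance `0`, for which the cube itself takes the role of the ball. -/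
lemma IsLocal.card_le {w : ℕ} (hw : 0 < w) {C : Submodule (ZMod 2) (ι → ZMod 2)}
    (hC : IsLocal w C) :
    (Nat.card C : ℝ) ≤ 2 ^ (Fintype.card ι * (h (1 / 2) - c w (1 / 2))) := by
  classical
  have hh : h (1 / 2) = 1 := by
    have : Real.logb 2 (1 / 2) = -1 := by
      rw [one_div, Real.logb_inv, Real.logb_self_eq_one (by norm_num)]
    rw [h, show (1 : ℝ) - 1 / 2 = 1 / 2 by norm_num, this]; norm_num
  have h1 := hC.card_syndromes_le hw (τ := 1 / 2) (by norm_num) le_rfl univ fun x _ => by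
    have : ∀ i, (if x i = 0 then 1 - 1 / 2 else 1 / 2 : ℝ) = 2⁻¹ := by
      intro i; split_ifs <;> norm_num
    simp_rw [this, prod_const, card_univ, hh, mul_one, Real.rpow_neg zero_le_two,
      Real.rpow_natCast, inv_pow, le_refl]
  have h2 := card_le_card_syndromes C (d := 1) (lam := Fintype.card ι) zero_le_one
    (fun c _ hc => by
      have : 0 < hammingNorm c := hammingNorm_pos_iff.mpr hc
      exact_mod_cast this) univ (fun _ => 1) (fun _ => zero_le_one) (by simp) ⟨0, one_ne_zero⟩
    (by simp)
  linarith

/-- The bound at relative distance `δ > 0`. -/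
lemma exists_const_card_le {w : ℕ} (hw : 0 < w) {δ τ : ℝ} (hδ : 0 < δ) (h0 : 0 < τ)
    (h1 : τ < 1 / 2) (hδτ : 1 - 2 * δ < 2 * Real.sqrt (τ * (1 - τ))) :
    ∃ K : ℝ, 1 ≤ K ∧ ∀ (ι : Type) [Fintype ι] [DecidableEq ι]
      (C : Submodule (ZMod 2) (ι → ZMod 2)), IsLocal w C →
      (∀ c ∈ C, c ≠ 0 → δ * Fintype.card ι ≤ hammingNorm c) →
      (Nat.card C : ℝ) ≤ K * 2 ^ (Fintype.card ι * (h τ - c w τ)) := by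
  classical
  obtain ⟨m, hm1, hm2⟩ := exists_between hδτ
  obtain ⟨n₀, hn₀⟩ := exists_test_function h0 (by linarith) hm2
  have hη : 0 < m - 1 + 2 * δ := by linarith
  refine ⟨max (2 ^ n₀) (2 * δ / (m - 1 + 2 * δ)),
    (one_le_pow₀ one_le_two).trans (le_max_left _ _), fun ι _ _ C hC hd => ?_⟩
  set n : ℝ := (Fintype.card ι : ℝ) with hn
  rcases le_total (Fintype.card ι) n₀ with hle | hge
  · have e1 : Nat.card C ≤ 2 ^ n₀ := by
      calc Nat.card C ≤ Nat.card (ι → ZMod 2) :=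
            Nat.card_le_card_of_injective _ C.injective_subtype
        _ = 2 ^ Fintype.card ι := by simp
        _ ≤ 2 ^ n₀ := Nat.pow_le_pow_right (by norm_num) hle
    have e2 : (Nat.card C : ℝ) ≤ 2 ^ n₀ := by exact_mod_cast e1
    have e3 : (1 : ℝ) ≤ 2 ^ (n * (h τ - c w τ)) :=
      Real.one_le_rpow one_le_two
        (mul_nonneg (Nat.cast_nonneg _) (h_sub_c_nonneg hw h0.le h1.le))
    exact (e2.trans (le_max_left _ _)).trans (le_mul_of_one_le_right (by positivity) e3)
  · rcases isEmpty_or_nonempty ι with hι | hι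
    · have hn0 : n = 0 := by simp [hn]
      have e1 : Nat.card C ≤ 1 := Finite.card_le_one_iff_subsingleton.mpr inferInstance
      have e2 : (Nat.card C : ℝ) ≤ 1 := by exact_mod_cast e1
      rw [hn0, zero_mul, Real.rpow_zero, mul_one]
      exact e2.trans ((one_le_pow₀ one_le_two).trans (le_max_left _ _))
    have hnpos : 0 < n := Nat.cast_pos.mpr Fintype.card_pos
    obtain ⟨f, hf0, hfB, hne, hA⟩ := hn₀ ι hge
    set B : Finset (ι → ZMod 2) := {x | (hammingNorm x : ℝ) ≤ τ * n} with hB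
    have h2 := hC.card_syndromes_le hw h0 h1.le B fun x hx =>
      two_rpow_le_prod h0 h1.le x (mem_filter.mp hx).2
    have h3 := card_le_card_syndromes C (d := δ * n) (by positivity) hd B f hf0
      (fun x hx => hfB x (by simpa [hB] using hx)) hne hA
    have h4 : (m - 1 + 2 * δ) * Nat.card C ≤ 2 * δ * #(B.image (syndrome C)) := by
      refine le_of_mul_le_mul_left ?_ hnpos
      linarith
    have h5 : (Nat.card C : ℝ) ≤ 2 * δ / (m - 1 + 2 * δ) * #(B.image (syndrome C)) := by
      rw [div_mul_eq_mul_div, le_div_iff₀ hη]; linarith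
    refine h5.trans ?_
    exact mul_le_mul (le_max_right _ _) h2 (Nat.cast_nonneg _) (by positivity)

end

/-! ### Shortening -/

section

/-- In a local linear code, `r` coordinates out of each of `t` successive groups of `r + 1`
coordinates determine the groups. -/
lemma IsLocal.exists_determined {ι : Type*} [Fintype ι] [DecidableEq ι] {r : ℕ}
    {C : Submodule (ZMod 2) (ι → ZMod 2)} (hC : IsLocal (r + 1) C) (t : ℕ)
    (ht : t * (r + 1) ≤ Fintype.card ι) :
    ∃ I U : Finset ι, #I = t * (r + 1) ∧ #U = t * r ∧
      ∀ c ∈ C, (∀ i ∈ U, c i = 0) → ∀ i ∈ I, c i = 0 := by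
  induction t with
  | zero => exact ⟨∅, ∅, by simp⟩
  | succ t ih =>
    rw [Nat.succ_mul] at ht
    obtain ⟨I, U, hI, hU, hIU⟩ := ih (by omega)
    obtain ⟨i, -, hi⟩ := exists_mem_notMem_of_card_lt_card
      (show #I < #(univ : Finset ι) by rw [card_univ]; omega)
    obtain ⟨R, hiR, hRw, hR⟩ := hC i
    have hIR : #(I ∪ R) ≤ #I + (r + 1) := (card_union_le _ _).trans (by omega)
    -- a group that contains the repair group of a new coordinate `i`
    obtain ⟨I', hII', -, hI'⟩ := exists_subsuperset_card_eq (subset_univ (I ∪ R)) hIR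
      (by rw [card_univ]; omega)
    have hIsub : I ⊆ I' := subset_union_left.trans hII'
    have hRsub : R ⊆ I' := subset_union_right.trans hII'
    have hnew : #((I' \ I).erase i) = r := by
      rw [card_erase_of_mem (mem_sdiff.mpr ⟨hRsub hiR, hi⟩), card_sdiff_of_subset hIsub]
      omega
    have hUle : #(U ∪ (I' \ I).erase i) ≤ (t + 1) * r := by
      refine (card_union_le _ _).trans ?_
      rw [hnew, hU, Nat.succ_mul]
    obtain ⟨U', hUU', -, hU'⟩ := exists_subsuperset_card_eq (subset_univ (U ∪ (I' \ I).erase i))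
      hUle (by rw [card_univ, Nat.succ_mul]; nlinarith)
    refine ⟨I', U', by rw [hI', hI, Nat.succ_mul], hU', fun c hc hcU => ?_⟩
    have hcI := hIU c hc fun j hj => hcU j (hUU' (mem_union_left _ hj))
    have hcI' : ∀ j ∈ I', j ≠ i → c j = 0 := by
      intro j hj hji
      by_cases hjI : j ∈ I
      · exact hcI j hjI
      · exact hcU j (hUU' (mem_union_right _ (mem_erase.mpr ⟨hji, mem_sdiff.mpr ⟨hj, hjI⟩⟩)))
    intro j hj
    by_cases hji : j = i
    · subst hji
      exact hR c hc fun k hk hkj => hcI' k (hRsub hk) hkj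
    · exact hcI' j hj hji

/-- Shortening: removing `t` groups of `r + 1` coordinates from a local linear code costs at most
`t r` dimensions, and preserves locality and the minimum weight. -/
lemma IsLocal.exists_shortened {ι : Type} [Fintype ι] [DecidableEq ι] {r : ℕ}
    {C : Submodule (ZMod 2) (ι → ZMod 2)} (hC : IsLocal (r + 1) C) (t : ℕ)
    (ht : t * (r + 1) ≤ Fintype.card ι) {d : ℝ} (hd : ∀ c ∈ C, c ≠ 0 → d ≤ hammingNorm c) :
    ∃ (κ : Type) (_ : Fintype κ) (_ : DecidableEq κ) (C' : Submodule (ZMod 2) (κ → ZMod 2)),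
      Fintype.card κ = Fintype.card ι - t * (r + 1) ∧ IsLocal (r + 1) C' ∧
      (∀ c ∈ C', c ≠ 0 → d ≤ hammingNorm c) ∧ Nat.card C ≤ 2 ^ (t * r) * Nat.card C' := by
  obtain ⟨I, U, hI, hU, hIU⟩ := hC.exists_determined t ht
  set ext : ({i // i ∉ I} → ZMod 2) →ₗ[ZMod 2] (ι → ZMod 2) :=
    Function.ExtendByZero.linearMap (ZMod 2) Subtype.val with hext
  have hext1 : ∀ c (i : {i // i ∉ I}), ext c i.1 = c i := fun c i =>
    Subtype.val_injective.extend_apply c 0 i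
  have hext2 : ∀ c, ∀ i ∈ I, ext c i = 0 := fun c i hi =>
    Function.extend_apply' (f := (Subtype.val : {i // i ∉ I} → ι)) c 0 i
      (by rintro ⟨a, rfl⟩; exact a.2 hi)
  refine ⟨{i // i ∉ I}, inferInstance, inferInstance, C.comap ext, ?_, fun i => ?_,
    fun c hc hc0 => ?_, ?_⟩
  · rw [Fintype.card_subtype_compl, Fintype.card_coe, hI]
  · obtain ⟨R, hiR, hRw, hR⟩ := hC i.1
    refine ⟨R.subtype (· ∉ I), mem_subtype.mpr hiR, ?_, fun c hc hcR => ?_⟩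
    · rw [card_subtype]; exact (card_filter_le _ _).trans hRw
    · rw [← hext1 c i]
      refine hR _ hc fun j hj hji => ?_
      by_cases hjI : j ∈ I
      · exact hext2 c j hjI
      · rw [hext1 c ⟨j, hjI⟩]
        exact hcR _ (mem_subtype.mpr hj) fun e => hji (congrArg Subtype.val e)
  · have hne : ext c ≠ 0 := by
      intro h0
      refine hc0 (funext fun i => ?_)
      rw [← hext1 c i, h0]; rfl
    refine (hd _ hc hne).trans ?_
    have : hammingNorm (ext c) ≤ hammingNorm c := by
      unfold hammingNorm
      refine card_le_card_of_surjOn Subtype.val fun i hi => ?_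
      have hi' : ext c i ≠ 0 := by simpa using hi
      have hiI : i ∉ I := fun hiI => hi' (hext2 c i hiI)
      refine ⟨⟨i, hiI⟩, ?_, rfl⟩
      simpa [hext1 c ⟨i, hiI⟩] using hi'
    exact_mod_cast this
  · -- the codewords that vanish on `U` vanish on `I`
    set res : C →+ (U → ZMod 2) :=
      { toFun := fun c i => c.1 i.1
        map_zero' := rfl
        map_add' := fun _ _ => rfl } with hres
    have h1 := res.ker.card_mul_index
    rw [AddSubgroup.index_ker] at h1
    have h2 : Nat.card res.range ≤ 2 ^ (t * r) := by
      refine (Nat.card_le_card_of_injective _ res.range.subtype_injective).trans ?_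
      simp [hU]
    have hker : ∀ c : res.ker, ext (fun i => c.1.1 i.1) = c.1.1 := by
      intro c
      have hcU : ∀ i ∈ U, c.1.1 i = 0 := fun i hi => congrFun c.2 ⟨i, hi⟩
      funext i
      by_cases hi : i ∈ I
      · rw [hext2 _ i hi, hIU c.1.1 c.1.2 hcU i hi]
      · exact hext1 _ ⟨i, hi⟩
    have h3 : Nat.card res.ker ≤ Nat.card (C.comap ext) := by
      refine Nat.card_le_card_of_injective (fun c => ⟨fun i => c.1.1 i.1, ?_⟩) fun c c' hcc' => ?_
      · rw [Submodule.mem_comap, hker]; exact c.1.2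
      · have := congrArg (fun x : C.comap ext => ext x.1) hcc'
        simp only [hker] at this
        exact Subtype.ext (Subtype.ext this)
    rw [← h1, mul_comm]
    exact Nat.mul_le_mul h2 h3

end

/-! ### The asymptotic bound -/

section

lemma h_eq_negMulLog (x : ℝ) :
    h x = (Real.negMulLog x + Real.negMulLog (1 - x)) / Real.log 2 := by
  simp only [h, Real.logb, Real.negMulLog]; ring

lemma continuous_h : Continuous h := by
  simp_rw [funext h_eq_negMulLog]
  exact (Real.continuous_negMulLog.add
    (Real.continuous_negMulLog.comp (continuous_const.sub continuous_id))).div_const _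

lemma continuous_c (w : ℕ) : Continuous (c w) := by
  unfold c; fun_prop

lemma continuous_tau : Continuous tau := by
  unfold tau; fun_prop

lemma continuous_R0 (r : ℕ) : Continuous (R0 r) :=
  (continuous_h.comp continuous_tau).sub ((continuous_c _).comp continuous_tau)

lemma tau_le_half (δ : ℝ) : tau δ ≤ 1 / 2 := by
  have := Real.sqrt_nonneg (δ * (1 - δ))
  unfold tau; linarith

lemma tau_nonneg (δ : ℝ) : 0 ≤ tau δ := by
  have : Real.sqrt (δ * (1 - δ)) ≤ 1 / 2 := by
    rw [Real.sqrt_le_left (by norm_num)]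
    nlinarith [sq_nonneg (δ - 1 / 2)]
  unfold tau; linarith

lemma tau_zero : tau 0 = 1 / 2 := by simp [tau]

lemma tau_half : tau (1 / 2) = 0 := by
  have : (1 / 2 * (1 - 1 / 2) : ℝ) = (1 / 2) ^ 2 := by norm_num
  rw [tau, this, Real.sqrt_sq (by norm_num), sub_self]

lemma R0_nonneg (r : ℕ) (δ : ℝ) : 0 ≤ R0 r δ :=
  h_sub_c_nonneg r.succ_pos (tau_nonneg δ) (tau_le_half δ)

/-- A radius slightly larger than `tau δ` gives the cube restricted to the ball a spectral radius
larger than `(1 - 2 δ) n`. -/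
lemma lt_two_mul_sqrt {δ τ : ℝ} (h0 : 0 ≤ δ) (h1 : δ ≤ 1 / 2) (hτ : tau δ < τ)
    (hτ1 : τ < 1 / 2) : 1 - 2 * δ < 2 * Real.sqrt (τ * (1 - τ)) := by
  have hδ : 0 ≤ δ * (1 - δ) := mul_nonneg h0 (by linarith)
  have hs := Real.sqrt_nonneg (δ * (1 - δ))
  have hs2 := Real.sq_sqrt hδ
  rw [tau] at hτ
  have key : (1 - 2 * δ) / 2 < Real.sqrt (τ * (1 - τ)) := by
    rw [Real.lt_sqrt (by linarith)]
    nlinarith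
  linarith

/-- Local linear codes of relative distance `δ` have rate at most `R0 r δ + ε`. -/
lemma exists_const_card_le_R0 (r : ℕ) {δ ε : ℝ} (h0 : 0 ≤ δ) (hε : 0 < ε) :
    ∃ K : ℝ, 1 ≤ K ∧ ∀ (ι : Type) [Fintype ι] [DecidableEq ι]
      (C : Submodule (ZMod 2) (ι → ZMod 2)), IsLocal (r + 1) C →
      (∀ c ∈ C, c ≠ 0 → δ * Fintype.card ι ≤ hammingNorm c) →
      (Nat.card C : ℝ) ≤ K * 2 ^ (Fintype.card ι * (R0 r δ + ε)) := by
  rcases le_or_gt δ (1 / 2) with h1 | h1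
  · rcases h0.eq_or_lt with rfl | h0
    · refine ⟨1, le_rfl, fun ι _ _ C hC _ => ?_⟩
      rw [one_mul]
      refine (hC.card_le r.succ_pos).trans (Real.rpow_le_rpow_of_exponent_le one_le_two ?_)
      refine mul_le_mul_of_nonneg_left ?_ (Nat.cast_nonneg _)
      rw [R0, tau_zero]
      linarith
    · have hτ1 : tau δ < 1 / 2 := by
        have : 0 < Real.sqrt (δ * (1 - δ)) := Real.sqrt_pos.mpr (mul_pos h0 (by linarith))
        rw [tau]; linarith
      have hcont : ContinuousAt (fun τ => h τ - c (r + 1) τ) (tau δ) :=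
        (continuous_h.sub (continuous_c _)).continuousAt
      have hev : ∀ᶠ τ in nhds (tau δ), h τ - c (r + 1) τ < R0 r δ + ε :=
        hcont.eventually_lt_const (by rw [R0]; linarith)
      obtain ⟨τ, ⟨hτε, hτhalf⟩, hτ⟩ :=
        ((hev.and (eventually_lt_nhds hτ1)).filter_mono nhdsWithin_le_nhds |>.and
          (self_mem_nhdsWithin : Set.Ioi (tau δ) ∈ nhdsWithin (tau δ) (Set.Ioi (tau δ)))).exists
      obtain ⟨K, hK1, hK⟩ := exists_const_card_le r.succ_pos h0 ((tau_nonneg δ).trans_lt hτ) hτhalf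
        (lt_two_mul_sqrt h0.le h1 hτ hτhalf)
      refine ⟨K, hK1, fun ι _ _ C hC hd => (hK ι C hC hd).trans ?_⟩
      refine mul_le_mul_of_nonneg_left (Real.rpow_le_rpow_of_exponent_le one_le_two ?_)
        (by linarith)
      exact mul_le_mul_of_nonneg_left hτε.le (Nat.cast_nonneg _)
  · -- beyond relative distance `1 / 2` the rate is already `0`
    have hev : ∀ᶠ τ in nhds (0 : ℝ), h τ - c (r + 1) τ < ε :=
      (continuous_h.sub (continuous_c _)).continuousAt.eventually_lt_const (by simp [h, c, hε])
    obtain ⟨τ, ⟨hτε, hτhalf⟩, hτ⟩ :=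
      ((hev.and (eventually_lt_nhds one_half_pos)).filter_mono nhdsWithin_le_nhds |>.and
        (self_mem_nhdsWithin : Set.Ioi (0 : ℝ) ∈ nhdsWithin 0 (Set.Ioi 0))).exists
    obtain ⟨K, hK1, hK⟩ := exists_const_card_le r.succ_pos one_half_pos hτ hτhalf
      (lt_two_mul_sqrt one_half_pos.le le_rfl (by rwa [tau_half]) hτhalf)
    refine ⟨K, hK1, fun ι _ _ C hC hd => (hK ι C hC fun c hc hc0 => ?_).trans ?_⟩
    · exact (mul_le_mul_of_nonneg_right h1.le (Nat.cast_nonneg _)).trans (hd c hc hc0)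
    · refine mul_le_mul_of_nonneg_left (Real.rpow_le_rpow_of_exponent_le one_le_two ?_)
        (by linarith)
      refine mul_le_mul_of_nonneg_left ?_ (Nat.cast_nonneg _)
      have := R0_nonneg r δ
      linarith

lemma HasLocality.isLocal {n r : ℕ} {C : Submodule (ZMod 2) (Fin n → ZMod 2)}
    (hC : HasLocality r (C : Set (Fin n → ZMod 2))) : IsLocal (r + 1) C := by
  intro i
  obtain ⟨R, hiR, hRr, φ, hφ⟩ := hC i
  refine ⟨R, hiR, hRr.le, fun c hc hcR => ?_⟩
  have e : (fun j : {j // j ∈ R.erase i} => c j) =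
      fun j => (0 : Fin n → ZMod 2) j.1 := by
    funext j
    exact hcR j (mem_of_mem_erase j.2) (ne_of_mem_erase j.2)
  rw [hφ c hc, e, ← hφ 0 C.zero_mem]
  rfl

lemma maxLinCard_le {n r : ℕ} {d Z : ℝ} (hZ : 0 ≤ Z)
    (hbd : ∀ C : Submodule (ZMod 2) (Fin n → ZMod 2), (∀ c ∈ C, c ≠ 0 → d ≤ hammingNorm c) →
      IsLocal (r + 1) C → (Nat.card C : ℝ) ≤ Z) : (maxLinCard n r d : ℝ) ≤ Z := by
  refine le_trans (Nat.cast_le.mpr (csSup_le' ?_)) (Nat.floor_le hZ)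
  rintro M ⟨C, hd, hC, rfl⟩
  refine Nat.le_floor (hbd C (fun c hc hc0 => ?_) hC.isLocal)
  simpa using hd c hc 0 C.zero_mem hc0

/-- The finite-length bound: `⌈s n⌉` groups of `r + 1` coordinates are removed by shortening, and
the rate bound applies to the code that remains. -/
lemma eventually_logb_maxLinCard_le {r : ℕ} {δ s ε : ℝ} (hδ : 0 ≤ δ) (hs : s ∈ range r δ)
    (hε : 0 < ε) :
    ∀ᶠ n : ℕ in Filter.atTop,
      1 / (n : ℝ) * Real.logb 2 (maxLinCard n r (δ * n) : ℝ) ≤ bound r δ s + ε := by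
  obtain ⟨hs0, hs1, -⟩ := hs
  set e : ℝ := 1 - s * (r + 1) with he
  have hr1 : (0 : ℝ) < r + 1 := by positivity
  have he0 : 0 < e := by
    rw [lt_div_iff₀ hr1] at hs1; linarith
  have he1 : e ≤ 1 := by
    have := mul_nonneg hs0 hr1.le; linarith
  obtain ⟨K, hK1, hK⟩ := exists_const_card_le_R0 r (div_nonneg hδ he0.le) (half_pos hε)
  set ρ := R0 r (δ / e) with hρ
  have hρ0 : 0 ≤ ρ := R0_nonneg _ _
  have hKlog : 0 ≤ Real.logb 2 K := Real.logb_nonneg one_lt_two hK1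
  obtain ⟨N, hN⟩ := exists_nat_gt (max ((r + 1) / e) ((r + Real.logb 2 K) / (ε / 2)))
  filter_upwards [Filter.eventually_ge_atTop N] with n hn
  have hnN : (N : ℝ) ≤ n := Nat.cast_le.mpr hn
  have hn1 : (r : ℝ) + 1 ≤ e * n := by
    have := ((le_max_left _ _).trans_lt hN).le.trans hnN
    rwa [div_le_iff₀ he0, mul_comm] at this
  have hn2 : r + Real.logb 2 K ≤ ε / 2 * n := by
    have := ((le_max_right _ _).trans_lt hN).le.trans hnN
    rwa [div_le_iff₀ (half_pos hε), mul_comm] at this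
  have hn0 : (0 : ℝ) < n := by
    by_contra hneg; nlinarith
  set t := ⌈s * n⌉₊ with ht
  have ht1 : s * n ≤ t := Nat.le_ceil _
  have ht2 : (t : ℝ) ≤ s * n + 1 := (Nat.ceil_lt_add_one (by positivity)).le
  have htn : t * (r + 1) ≤ n := by
    have : (t : ℝ) * (r + 1) ≤ n := by
      have := mul_le_mul_of_nonneg_right ht2 hr1.le
      rw [he] at hn1
      linarith
    exact_mod_cast this
  set L : ℝ := (s * n + 1) * r + Real.logb 2 K + e * n * (ρ + ε / 2) with hL
  have hL0 : 0 ≤ L := by positivity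
  have hmax : (maxLinCard n r (δ * n) : ℝ) ≤ 2 ^ L := by
    refine maxLinCard_le (by positivity) fun C hd hC => ?_
    obtain ⟨κ, _, _, C', hcard, hC', hd', hCC'⟩ := hC.exists_shortened t (by simpa using htn) hd
    have hcardR : (Fintype.card κ : ℝ) ≤ e * n := by
      rw [hcard, Fintype.card_fin, Nat.cast_sub htn]
      push_cast
      have := mul_le_mul_of_nonneg_right ht1 hr1.le
      rw [he]
      linarith
    have hdκ : δ / e * Fintype.card κ ≤ δ * n := by
      calc δ / e * Fintype.card κ ≤ δ / e * (e * n) :=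
            mul_le_mul_of_nonneg_left hcardR (div_nonneg hδ he0.le)
        _ = δ * n := by field_simp
    have hbd := hK κ C' hC' fun c hc hc0 => hdκ.trans (hd' c hc hc0)
    have hCR : (Nat.card C : ℝ) ≤ 2 ^ (t * r) * Nat.card C' := by exact_mod_cast hCC'
    have hK2 : K = 2 ^ Real.logb 2 K :=
      (Real.rpow_logb two_pos (by norm_num) (by linarith)).symm
    calc (Nat.card C : ℝ) ≤ 2 ^ (t * r) * (K * 2 ^ (Fintype.card κ * (ρ + ε / 2))) :=
          hCR.trans (mul_le_mul_of_nonneg_left hbd (by positivity))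
      _ = 2 ^ ((t * r : ℝ) + Real.logb 2 K + Fintype.card κ * (ρ + ε / 2)) := by
          rw [Real.rpow_add two_pos, Real.rpow_add two_pos, ← hK2, ← mul_assoc]
          congr 2
          rw [← Real.rpow_natCast]; push_cast; rfl
      _ ≤ 2 ^ L := by
          refine Real.rpow_le_rpow_of_exponent_le one_le_two ?_
          have h1 := mul_le_mul_of_nonneg_right ht2 (Nat.cast_nonneg (α := ℝ) r)
          have h2 := mul_le_mul_of_nonneg_right hcardR (show 0 ≤ ρ + ε / 2 by positivity)
          rw [hL]
          linarith
  have hlog : Real.logb 2 (maxLinCard n r (δ * n) : ℝ) ≤ L := by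
    rcases (Nat.cast_nonneg (α := ℝ) (maxLinCard n r (δ * n))).eq_or_lt with h0 | hpos
    · -- there is no code, and the logarithm takes its value `0` at `0`
      rw [← h0, Real.logb_zero]; exact hL0
    · exact (Real.logb_le_iff_le_rpow one_lt_two hpos).mpr hmax
  rw [one_div_mul_eq_div, div_le_iff₀ hn0]
  refine hlog.trans ?_
  have hb : bound r δ s = s * r + e * ρ := rfl
  have h3 : e * n * (ε / 2) ≤ n * (ε / 2) :=
    mul_le_mul_of_nonneg_right (mul_le_of_le_one_left hn0.le he1) (half_pos hε).le
  rw [hb, hL]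
  linarith

lemma linRate_le_bound {r : ℕ} {δ s : ℝ} (hδ : 0 ≤ δ) (hs : s ∈ range r δ) :
    linRate r δ ≤ bound r δ s := by
  refine le_of_forall_pos_le_add fun ε hε => ?_
  refine Filter.limsup_le_of_le ?_ (eventually_logb_maxLinCard_le hδ hs hε)
  refine Filter.isCoboundedUnder_le_of_le Filter.atTop (x := 0) fun n => ?_
  refine mul_nonneg (by positivity) ?_
  rcases Nat.eq_zero_or_pos (maxLinCard n r (δ * n)) with h0 | hpos
  · rw [h0, Nat.cast_zero, Real.logb_zero]
  · exact Real.logb_nonneg one_lt_two (by exact_mod_cast hpos)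

lemma range_eq_Icc (r : ℕ) {δ : ℝ} (hδ : 0 < δ) :
    range r δ = Set.Icc 0 ((1 - δ) / (r + 1)) := by
  have hr1 : (0 : ℝ) < r + 1 := by positivity
  ext s
  simp only [range, Set.mem_ofPred_eq, Set.mem_Icc, lt_div_iff₀ hr1, le_div_iff₀ hr1]
  refine and_congr_right fun _ => ⟨fun ⟨h1, h2⟩ => ?_, fun h1 => ⟨by linarith, ?_⟩⟩
  · rw [div_le_one (by linarith)] at h2; linarith
  · rw [div_le_one (by linarith)]; linarith

lemma exists_isMinOn_bound (r : ℕ) {δ : ℝ} (hδ : 0 < δ) (hδ1 : δ ≤ 1) :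
    ∃ s₀ ∈ range r δ, IsMinOn (bound r δ) (range r δ) s₀ := by
  have hr1 : (0 : ℝ) < r + 1 := by positivity
  have hcont : ContinuousOn (bound r δ) (range r δ) := by
    have hlin : ContinuousOn (fun s : ℝ => 1 - s * (r + 1)) (range r δ) := by fun_prop
    have hdiv : ContinuousOn (fun s : ℝ => δ / (1 - s * (r + 1))) (range r δ) :=
      continuousOn_const.div hlin fun s hs => by
        have := (lt_div_iff₀ hr1).mp hs.2.1
        linarith
    exact (continuousOn_id.mul continuousOn_const).add
      (hlin.mul ((continuous_R0 r).comp_continuousOn hdiv))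
  rw [range_eq_Icc r hδ] at hcont ⊢
  exact isCompact_Icc.exists_isMinOn (Set.nonempty_Icc.mpr (div_nonneg (by linarith) hr1.le)) hcont

end

end LRC


theorem mainTheorem3 (r : ℕ) (δ : ℝ) (hδ : δ ∈ Set.Icc (0 : ℝ) (1 / 2)) :
    (∀ s ∈ LRC.range r δ, LRC.linRate r δ ≤ LRC.bound r δ s) ∧
    (0 < δ → ∃ s₀ ∈ LRC.range r δ, IsMinOn (LRC.bound r δ) (LRC.range r δ) s₀) :=
  ⟨fun _ hs => LRC.linRate_le_bound hδ.1 hs,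
    fun h0 => LRC.exists_isMinOn_bound r h0 (hδ.2.trans (by norm_num))⟩
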